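/- Let $p$ be a prime and $G$ a finite $p$-group with exponent-$p$ central series $\eta$: $\eta_0=\eta_1=G$ and $\eta_{i+1}=[G,\eta_i]\,\eta_i^p$ for $i\ge 1$, where $\eta_i^p=\langle x^p : x\in\eta_i\rangle$. Assume that $\dim_{\mathbb Z/p}(\eta_1/\eta_2)$ is odd, that $\dim_{\mathbb Z/p}(\eta_2/\eta_3)=2$, and that the commutation map $\eta_1/\eta_2\times\eta_1/\eta_2\to\eta_2/\eta_3$ is not identically zero, i.e. $[G,G]\not\le\eta_3$. Then $\eta$ has a proper lex-least adjoint refinement. Here a filter on $G$ over a commutative monoid $M$ is a family of subgroups $(\phi_s)_{s\in M}$ with $\phi_0=G$ and $[\phi_s,\phi_t]\le\phi_{s+t}\le\phi_s\cap\phi_t$; the series $\eta$ is a filter over $\mathbb N$. For a filter $\phi$ over $\mathbb N$ put $L_s=\phi_s/\phi_{s+1}$ for $s\geq 1$. Let $s\ge 1$ be least with $L_s\ne 0$, let $[\,,]:L_s\times L_s\to L_{2s}$ be the biadditive map induced by commutators, let $$\mathrm{Adj}=\{(X,Y)\in \mathrm{End}(L_s)\times\mathrm{End}(L_s)^{\mathrm{op}}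 : [uX,v]=[u,Yv]\ \text{ for all } u,v\in L_s\},$$ let $J$ be the Jacobson radical of $\mathrm{Adj}$, and let $\phi_{s+1}\le H_i\le\phi_s$ be given by $H_i/\phi_{s+1}=L_sJ^i$ ($i\ge 0$, $J^0=\mathrm{Adj}$). Order $\mathbb N^2$ lexicographically with the first coordinate dominant, let $X=\{x\in\mathbb N^2 : x<(s+1,0)\}$, and for $(u,i)\in X$ set $\pi_{(u,i)}=\phi_u$ if $i=0$ or $u\ne s$, and $\pi_{(s,i)}=H_i$. The lex-least adjoint refinement of $\phi$ is the family $$\alpha_x=\prod_{\substack{x_1,\dots,x_d\in X,\ d\ge 1\\ x_1+\cdots+x_d=x}}[\pi_{x_1},\dots,\pi_{x_d}]\qquad(x\in\mathbb N^2),$$ with left-normed commutators of subgroups. It is a proper refinement of $\phi$ when $\alpha$ is a filter over $\mathbb N^2$ that is order-reversing for the lexicographic order, $\alpha_{(u,i)}\le\phi_u$ for all $u,i$, $\alpha_{(u,0)}=\phi_u$ for all $u\le s$, $\alpha_{(s,c)}=\phi_{s+1}$ for some $c$, and $\phi_{s+1}<\alpha_{(s,i)}<\phi_s$ (strict inclusions)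 for some $i$. -/

import Mathlib

namespace AdjRefine

/-- A filter on `G` indexed by the commutative monoid `M`: subgroups `φ s` with `φ 0 = G` and
`[φ s, φ t] ≤ φ (s + t) ≤ φ s ∩ φ t`. -/
structure IsFilter {M : Type*} [AddCommMonoid M] {G : Type*} [Group G] (φ : M → Subgroup G) :
    Prop where
  zero : φ 0 = ⊤
  commutator_le : ∀ s t, ⁅φ s, φ t⁆ ≤ φ (s + t)
  le_inf : ∀ s t, φ (s + t) ≤ φ s ⊓ φ t

/-- A filter indexed by `ℕ`. -/
structure NatFilter (G : Type*) [Group G] where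
  toFun : ℕ → Subgroup G
  isFilter : IsFilter toFun

namespace NatFilter

variable {G : Type*} [Group G]

instance : CoeFun (NatFilter G) (fun _ => ℕ → Subgroup G) := ⟨NatFilter.toFun⟩

theorem antitone (φ : NatFilter G) {s t : ℕ} (h : s ≤ t) : φ t ≤ φ s := by
  obtain ⟨k, rfl⟩ := Nat.exists_eq_add_of_le h
  exact (φ.isFilter.le_inf s k).trans inf_le_left

/-- The commutator `x⁻¹ y⁻¹ x y` lies in `φ (s + t)`. -/
theorem comm_mem (φ : NatFilter G) {s t : ℕ} {x y : G} (hx : x ∈ φ s) (hy : y ∈ φ t) :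
    x⁻¹ * y⁻¹ * x * y ∈ φ (s + t) := by
  have h := φ.isFilter.commutator_le s t
    (Subgroup.commutator_mem_commutator ((φ s).inv_mem hx) ((φ t).inv_mem hy))
  simpa [commutatorElement_def] using h

instance normal (φ : NatFilter G) (s : ℕ) : (φ s).Normal := by
  refine ⟨fun n hn g => ?_⟩
  have h := φ.comm_mem (s := 0) (x := g⁻¹) (y := n⁻¹)
    (by rw [φ.isFilter.zero]; trivial) ((φ s).inv_mem hn)
  rw [zero_add, inv_inv, inv_inv] at h
  simpa using (φ s).mul_mem h hn

/-- The homogeneous component `L_s = φ_s / φ_s⁺`, written additively. Over `ℕ` the subgroup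
`φ_s⁺`, generated by all `φ_{s+t}` with `t ≠ 0`, is `φ_{s+1}`. -/
def Layer (φ : NatFilter G) (s : ℕ) : Type _ :=
  Additive (φ s ⧸ (φ (s + 1)).subgroupOf (φ s))

instance (φ : NatFilter G) (s : ℕ) : AddGroup (φ.Layer s) :=
  inferInstanceAs (AddGroup (Additive (φ s ⧸ (φ (s + 1)).subgroupOf (φ s))))

/-- The class in `L_s` of an element of `φ_s`. -/
def toLayer (φ : NatFilter G) (s : ℕ) (x : φ s) : φ.Layer s :=
  Additive.ofMul (QuotientGroup.mk x)

theorem toLayer_surjective (φ : NatFilter G) (s : ℕ) : Function.Surjective (φ.toLayer s) := by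
  intro u
  obtain ⟨x, hx⟩ := QuotientGroup.mk_surjective (Additive.toMul u)
  exact ⟨x, by rw [toLayer, hx]; rfl⟩

theorem toLayer_eq_iff (φ : NatFilter G) (s : ℕ) (x y : φ s) :
    φ.toLayer s x = φ.toLayer s y ↔ (x : G)⁻¹ * y ∈ φ (s + 1) :=
  (QuotientGroup.eq (s := (φ (s + 1)).subgroupOf (φ s)) (a := x) (b := y)).trans Iff.rfl

theorem toLayer_mul (φ : NatFilter G) (s : ℕ) (x y : φ s) :
    φ.toLayer s (x * y) = φ.toLayer s x + φ.toLayer s y := rfl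

/-- The quotient map `φ_s → L_s`, with `L_s` written multiplicatively. -/
def toLayerHom (φ : NatFilter G) (s : ℕ) : φ s →* Multiplicative (φ.Layer s) :=
  MonoidHom.mk' (fun x => Multiplicative.ofAdd (φ.toLayer s x)) (fun _ _ => rfl)

instance (φ : NatFilter G) (s : ℕ) [NeZero s] : AddCommGroup (φ.Layer s) :=
  { (inferInstance : AddGroup (φ.Layer s)) with
    add_comm := by
      intro u v
      obtain ⟨x, rfl⟩ := φ.toLayer_surjective s u
      obtain ⟨y, rfl⟩ := φ.toLayer_surjective s v
      rw [← toLayer_mul, ← toLayer_mul, toLayer_eq_iff]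
      have h := φ.antitone (Nat.add_le_add_left (NeZero.one_le (n := s)) s)
        (φ.comm_mem y.2 x.2)
      simpa [mul_assoc] using h }

/-- The commutator of representatives, as a map `φ_s × φ_t → L_{s+t}`. -/
def commMap (φ : NatFilter G) (s t : ℕ) (x : φ s) (y : φ t) : φ.Layer (s + t) :=
  φ.toLayer (s + t) ⟨(x : G)⁻¹ * (y : G)⁻¹ * x * y, φ.comm_mem x.2 y.2⟩

theorem commMap_mul_left (φ : NatFilter G) (s t : ℕ) [NeZero s] (x x' : φ s) (y : φ t) :
    φ.commMap s t (x * x') y = φ.commMap s t x y + φ.commMap s t x' y := by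
  unfold commMap
  rw [← toLayer_mul, toLayer_eq_iff]
  have hs := NeZero.one_le (n := s)
  have h := φ.comm_mem x'.2 (φ.comm_mem x.2 y.2)
  have h' := φ.antitone (show s + t + 1 ≤ s + (s + t) by omega) h
  have h2 := (φ.normal (s + t + 1)).conj_mem _ h'
    (((x' : G)⁻¹ * (y : G)⁻¹ * x' * y)⁻¹)
  convert h2 using 1
  simp only [Subgroup.coe_mul]
  group

theorem commMap_mul_right (φ : NatFilter G) (s t : ℕ) [NeZero t] (x : φ s) (y y' : φ t) :
    φ.commMap s t x (y * y') = φ.commMap s t x y + φ.commMap s t x y' := by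
  unfold commMap
  rw [← toLayer_mul, toLayer_eq_iff]
  have hs := NeZero.one_le (n := t)
  have h := φ.comm_mem (φ.comm_mem x.2 y.2) (φ.comm_mem x.2 y'.2)
  have h1 := φ.comm_mem y'.2 (φ.comm_mem x.2 y.2)
  have h' := φ.antitone (show s + t + 1 ≤ s + t + (s + t) by omega) h
  have h1' := φ.antitone (show s + t + 1 ≤ t + (s + t) by omega) h1
  convert (φ (s + t + 1)).mul_mem h1' h' using 1
  simp only [Subgroup.coe_mul]
  group

instance neZero_add (s t : ℕ) [NeZero s] : NeZero (s + t) :=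
  ⟨by have := NeZero.ne s; omega⟩

theorem commMap_eq_zero_right (φ : NatFilter G) (s t : ℕ) [NeZero t] (x : φ s) (y : φ t)
    (hy : (y : G) ∈ φ (t + 1)) : φ.commMap s t x y = 0 := by
  refine ((φ.toLayer_eq_iff (s + t) 1 _).2 ?_).symm
  simpa [add_assoc] using φ.comm_mem x.2 hy

theorem commMap_eq_zero_left (φ : NatFilter G) (s t : ℕ) [NeZero s] (x : φ s) (y : φ t)
    (hx : (x : G) ∈ φ (s + 1)) : φ.commMap s t x y = 0 := by
  refine ((φ.toLayer_eq_iff (s + t) 1 _).2 ?_).symm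
  have h := φ.comm_mem hx y.2
  rw [add_right_comm] at h
  simpa using h

/-- The map `L_t → L_{s+t}` induced by `y ↦ [x, y]`, for a fixed `x ∈ φ_s`. -/
def bracketRight (φ : NatFilter G) (s t : ℕ) [NeZero s] [NeZero t] (x : φ s) :
    φ.Layer t →+ φ.Layer (s + t) :=
  MonoidHom.toAdditiveLeft <| QuotientGroup.lift _
    (MonoidHom.mk' (fun y : φ t => Multiplicative.ofAdd (φ.commMap s t x y))
      (fun y y' => congrArg Multiplicative.ofAdd (φ.commMap_mul_right s t x y y')))
    (fun y hy => congrArg Multiplicative.ofAdd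
      (φ.commMap_eq_zero_right s t x y (Subgroup.mem_subgroupOf.1 hy)))

theorem bracketRight_toLayer (φ : NatFilter G) (s t : ℕ) [NeZero s] [NeZero t] (x : φ s)
    (y : φ t) : φ.bracketRight s t x (φ.toLayer t y) = φ.commMap s t x y := rfl

/-- The graded product `[,] : L_s × L_t → L_{s+t}`, induced by commutators. -/
def bracket (φ : NatFilter G) (s t : ℕ) [NeZero s] [NeZero t] :
    φ.Layer s →+ φ.Layer t →+ φ.Layer (s + t) :=
  MonoidHom.toAdditiveLeft <| QuotientGroup.lift _
    (MonoidHom.mk' (fun x : φ s => Multiplicative.ofAdd (φ.bracketRight s t x))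
      (fun x x' => congrArg Multiplicative.ofAdd <| by
        refine DFunLike.ext _ _ fun v => ?_
        obtain ⟨y, rfl⟩ := φ.toLayer_surjective t v
        exact φ.commMap_mul_left s t x x' y))
    (fun x hx => congrArg Multiplicative.ofAdd <| by
        refine DFunLike.ext _ _ fun v => ?_
        obtain ⟨y, rfl⟩ := φ.toLayer_surjective t v
        exact φ.commMap_eq_zero_left s t x y (Subgroup.mem_subgroupOf.1 hx))

theorem bracket_toLayer (φ : NatFilter G) (s t : ℕ) [NeZero s] [NeZero t] (x : φ s) (y : φ t) :
    φ.bracket s t (φ.toLayer s x) (φ.toLayer t y) =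
      φ.toLayer (s + t) ⟨(x : G)⁻¹ * (y : G)⁻¹ * x * y, φ.comm_mem x.2 y.2⟩ := rfl

/-- The ring of adjoints of `[,] : L_s × L_t → L_{s+t}`: the pairs `(X, Y)` in
`End L_s × (End L_t)ᵒᵖ` with `[X u, v] = [u, Y v]`. Endomorphisms act on the left here; writing
them on the right instead gives the opposite ring, which has the same Jacobson radical and the
same powers of it. -/
def Adj (φ : NatFilter G) (s t : ℕ) [NeZero s] [NeZero t] :
    Subring (AddMonoid.End (φ.Layer s) × (AddMonoid.End (φ.Layer t))ᵐᵒᵖ) where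
  carrier := {A | ∀ (u : φ.Layer s) (v : φ.Layer t),
    φ.bracket s t (A.1 u) v = φ.bracket s t u (A.2.unop v)}
  one_mem' := fun _ _ => rfl
  mul_mem' := fun {A B} hA hB u v => (hA (B.1 u) v).trans (hB u (A.2.unop v))
  zero_mem' := fun u v => by
    change φ.bracket s t 0 v = φ.bracket s t u 0
    simp
  add_mem' := fun {A B} hA hB u v => by
    change φ.bracket s t (A.1 u + B.1 u) v = φ.bracket s t u (A.2.unop v + B.2.unop v)
    rw [map_add, map_add, AddMonoidHom.add_apply, hA, hB]
  neg_mem' := fun {A} hA u v => by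
    change φ.bracket s t (-(A.1 u)) v = φ.bracket s t u (-(A.2.unop v))
    rw [map_neg, map_neg, AddMonoidHom.neg_apply, hA]

/-- The ring of adjoints as a type. -/
def AdjRing (φ : NatFilter G) (s t : ℕ) [NeZero s] [NeZero t] : Type _ := φ.Adj s t

instance (φ : NatFilter G) (s t : ℕ) [NeZero s] [NeZero t] : Ring (φ.AdjRing s t) :=
  inferInstanceAs (Ring (φ.Adj s t))

/-- The action of the ring of adjoints of `[,] : L_s × L_t → L_{s+t}` on `L_s`,
`(X, Y) ↦ X`. -/
def actLeft (φ : NatFilter G) (s t : ℕ) [NeZero s] [NeZero t] :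
    φ.AdjRing s t →+* AddMonoid.End (φ.Layer s) :=
  (RingHom.fst _ _).comp (φ.Adj s t).subtype

/-- The subgroup `L_s Jⁱ` of `L_s`, for `J` the Jacobson radical of the ring of adjoints of
`[,] : L_s × L_s → L_{2s}`. -/
def radLayer (φ : NatFilter G) (s : ℕ) [NeZero s] (i : ℕ) : AddSubgroup (φ.Layer s) :=
  AddSubgroup.closure {w | ∃ A ∈ Ring.jacobson (φ.AdjRing s s) ^ i, ∃ u : φ.Layer s,
    φ.actLeft s s A u = w}

/-- The subgroup `H_i` with `φ_s⁺ ≤ H_i ≤ φ_s` and `H_i / φ_s⁺ = L_s Jⁱ`. -/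
def H (φ : NatFilter G) (s : ℕ) [NeZero s] (i : ℕ) : Subgroup G :=
  ((AddSubgroup.toSubgroup (φ.radLayer s i)).comap (φ.toLayerHom s)).map (φ s).subtype

theorem mem_H (φ : NatFilter G) (s : ℕ) [NeZero s] (i : ℕ) (g : G) :
    g ∈ φ.H s i ↔ ∃ h : g ∈ φ s, φ.toLayer s ⟨g, h⟩ ∈ φ.radLayer s i := by
  constructor
  · rintro ⟨x, hx, rfl⟩
    exact ⟨x.2, hx⟩
  · rintro ⟨h, hx⟩
    exact ⟨⟨g, h⟩, hx, rfl⟩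

/-- The function to be extended to a filter: `φ_u` if `i = 0` or `u ≠ s`, and `H_i` if `u = s`. -/
def preAdjoint (φ : NatFilter G) (s : ℕ) [NeZero s] (x : ℕ ×ₗ ℕ) : Subgroup G :=
  if (ofLex x).2 = 0 ∨ (ofLex x).1 ≠ s then φ (ofLex x).1 else φ.H s (ofLex x).2

end NatFilter

/-- The left-normed commutator `[A₁, …, A_d] = [[A₁, …, A_{d-1}], A_d]` of a nonempty list of
subgroups, given by its first member and the list of the others. -/
def iterComm {G : Type*} [Group G] (A : Subgroup G) (l : List (Subgroup G)) : Subgroup G :=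
  l.foldl (fun B C => ⁅B, C⁆) A

/-- The function `M → 2^G` generated by `π : X → 2^G`, where `X` generates the monoid `M`: its
value at `s` is the product of `[π_{s₁}, …, π_{s_d}]` over all nonempty sequences
`s₁, …, s_d` in `X` with sum `s`. -/
def generate {M : Type*} [AddCommMonoid M] {G : Type*} [Group G] (X : Set M)
    (π : M → Subgroup G) (s : M) : Subgroup G :=
  ⨆ (a : M) (l : List M) (_ : (∀ b ∈ a :: l, b ∈ X) ∧ (a :: l).sum = s),
    iterComm (π a) (l.map π)

/-- The filter on `ℕ × ℕ` (lexicographic order, first coordinate dominant) generated by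
the function `NatFilter.preAdjoint` on the set of all indices below `(s + 1, 0)`. -/
def adjointFilter {G : Type*} [Group G] (φ : NatFilter G) (s : ℕ) [NeZero s] :
    ℕ ×ₗ ℕ → Subgroup G :=
  generate {x | x < toLex (s + 1, 0)} (φ.preAdjoint s)

/-- `s` is the least nonzero index with `L_s ≠ 0`. -/
def IsFirstLayer {G : Type*} [Group G] (φ : NatFilter G) (s : ℕ) : Prop :=
  IsLeast {t : ℕ | t ≠ 0 ∧ φ t ≠ φ (t + 1)} s

/-- `α` is a proper refinement of `φ` in the component `s`: a filter that descends along the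
lexicographic order, agrees with `φ` down to `φ_s`, takes values strictly between `φ_s` and
`φ_{s+1}` and reaches `φ_{s+1}` inside the component `s`, and stays below `φ` throughout. -/
structure IsProperRefinement {G : Type*} [Group G] (φ : NatFilter G) (s : ℕ)
    (α : ℕ ×ₗ ℕ → Subgroup G) : Prop where
  isFilter : IsFilter α
  antitone : Antitone α
  le : ∀ u i, α (toLex (u, i)) ≤ φ u
  eq : ∀ u ≤ s, α (toLex (u, 0)) = φ u
  eventually_eq : ∃ c, α (toLex (s, c)) = φ (s + 1)
  proper : ∃ i, φ (s + 1) < α (toLex (s, i)) ∧ α (toLex (s, i)) < φ s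

/-- `φ` has a proper lex-least adjoint refinement. -/
def HasProperLexLeastAdjointRefinement {G : Type*} [Group G] (φ : NatFilter G) : Prop :=
  ∃ (s : ℕ) (_ : NeZero s), IsFirstLayer φ s ∧ IsProperRefinement φ s (adjointFilter φ s)

/-- The terms of the exponent-`p` central series `η` of `G`: `η₀ = η₁ = G` and
`η_{i+1} = [G, η_i] η_i^p` for `i > 0`. -/
def etaTerm (p : ℕ) (G : Type*) [Group G] : ℕ → Subgroup G
  | 0 => ⊤
  | 1 => ⊤
  | i + 2 => ⁅(⊤ : Subgroup G), etaTerm p G (i + 1)⁆ ⊔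
      Subgroup.closure {y | ∃ x ∈ etaTerm p G (i + 1), x ^ p = y}

theorem pow_mem_etaTerm (p : ℕ) (G : Type*) [Group G] {i : ℕ} (hi : i ≠ 0) {x : G}
    (hx : x ∈ etaTerm p G i) : x ^ p ∈ etaTerm p G (i + 1) := by
  obtain ⟨k, rfl⟩ := Nat.exists_eq_succ_of_ne_zero hi
  exact Subgroup.mem_sup_right (Subgroup.subset_closure ⟨x, hx, rfl⟩)

theorem comm_top_etaTerm (p : ℕ) (G : Type*) [Group G] (i : ℕ) :
    ⁅(⊤ : Subgroup G), etaTerm p G i⁆ ≤ etaTerm p G (i + 1) := by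
  cases i with
  | zero => exact le_top
  | succ k => exact le_sup_left

theorem etaTerm_normal (p : ℕ) (G : Type*) [Group G] (i : ℕ) : (etaTerm p G i).Normal := by
  induction i using Nat.strong_induction_on with
  | _ i ih =>
    match i, ih with
    | 0, _ => exact inferInstanceAs (⊤ : Subgroup G).Normal
    | 1, _ => exact inferInstanceAs (⊤ : Subgroup G).Normal
    | k + 2, ih =>
      have := ih (k + 1) (by omega)
      have : (Subgroup.closure {y | ∃ x ∈ etaTerm p G (k + 1), x ^ p = y}).Normal := by
        refine ⟨fun n hn g => ?_⟩
        induction hn using Subgroup.closure_induction with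
        | mem y hy =>
          obtain ⟨x, hx, rfl⟩ := hy
          exact Subgroup.subset_closure ⟨g * x * g⁻¹, this.conj_mem x hx g, conj_pow⟩
        | one => simp
        | mul a b _ _ ha hb => simpa [mul_assoc] using mul_mem ha hb
        | inv a _ ha => simpa [mul_assoc] using inv_mem ha
      exact Subgroup.sup_normal _ _

theorem etaTerm_succ_le (p : ℕ) (G : Type*) [Group G] (i : ℕ) :
    etaTerm p G (i + 1) ≤ etaTerm p G i := by
  match i with
  | 0 => exact le_top
  | k + 1 =>
    have := etaTerm_normal p G (k + 1)
    refine sup_le (Subgroup.commutator_le_right _ _) ((Subgroup.closure_le _).2 ?_)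
    rintro _ ⟨x, hx, rfl⟩
    exact pow_mem hx p

theorem etaTerm_antitone (p : ℕ) (G : Type*) [Group G] : Antitone (etaTerm p G) :=
  antitone_nat_of_succ_le (etaTerm_succ_le p G)

/-- The commutator of `A` and `B` lies in the normal subgroup `N` exactly when the images of `A`
and `B` in `G ⧸ N` commute. -/
theorem commutator_le_iff_map {G : Type*} [Group G] (A B N : Subgroup G) [N.Normal] :
    ⁅A, B⁆ ≤ N ↔ ⁅A.map (QuotientGroup.mk' N), B.map (QuotientGroup.mk' N)⁆ = ⊥ := by
  rw [← Subgroup.map_commutator, Subgroup.map_eq_bot_iff, QuotientGroup.ker_mk']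

theorem etaTerm_commutator_le (p : ℕ) (G : Type*) [Group G] (j i : ℕ) :
    ⁅etaTerm p G i, etaTerm p G j⁆ ≤ etaTerm p G (i + j) := by
  induction j generalizing i with
  | zero =>
    have := etaTerm_normal p G i
    exact Subgroup.commutator_le_left _ _
  | succ j ih =>
    rcases j with _ | k
    · rw [Subgroup.commutator_comm]
      exact comm_top_etaTerm p G i
    · rcases Nat.eq_zero_or_pos i with rfl | hi
      · have := etaTerm_normal p G (k + 1 + 1)
        rw [zero_add]
        exact Subgroup.commutator_le_right _ _
      have hN := etaTerm_normal p G (i + (k + 1 + 1))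
      rw [commutator_le_iff_map, Subgroup.commutator_comm,
        Subgroup.commutator_eq_bot_iff_le_centralizer, Subgroup.map_le_iff_le_comap]
      refine sup_le ?_ ((Subgroup.closure_le _).2 ?_)
      · rw [← Subgroup.map_le_iff_le_comap, ← Subgroup.commutator_eq_bot_iff_le_centralizer,
          Subgroup.map_commutator]
        apply Subgroup.commutator_commutator_eq_bot_of_rotate
        · rw [← Subgroup.map_commutator, ← commutator_le_iff_map]
          have h := Subgroup.commutator_mono (ih i) (le_refl (⊤ : Subgroup G))
          rw [Subgroup.commutator_comm (etaTerm p G i)] at h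
          refine h.trans ?_
          rw [Subgroup.commutator_comm]
          exact comm_top_etaTerm p G _
        · rw [← Subgroup.map_commutator, ← commutator_le_iff_map, Subgroup.commutator_comm _ ⊤]
          refine (Subgroup.commutator_mono (comm_top_etaTerm p G i) le_rfl).trans ?_
          refine (ih (i + 1)).trans (le_of_eq ?_)
          congr 1
          omega
      · rintro _ ⟨y, hy, rfl⟩
        rw [SetLike.mem_coe, Subgroup.mem_comap, Subgroup.mem_centralizer_iff]
        rintro _ ⟨x, hx, rfl⟩
        have hc : x * y * x⁻¹ * y⁻¹ ∈ etaTerm p G (i + (k + 1)) := ih i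
          (Subgroup.commutator_mem_commutator hx hy)
        have hp := pow_mem_etaTerm p G (by omega) hc
        have hcen : ∀ g : G, Commute (QuotientGroup.mk' (etaTerm p G (i + (k + 1 + 1))) g)
            (QuotientGroup.mk' _ (x * y * x⁻¹ * y⁻¹)) := by
          intro g
          have h := (commutator_le_iff_map ⊤ _ _).1 (comm_top_etaTerm p G (i + (k + 1)))
          rw [Subgroup.commutator_eq_bot_iff_le_centralizer] at h
          exact (Subgroup.mem_centralizer_iff.1 (h ⟨g, trivial, rfl⟩) _ ⟨_, hc, rfl⟩).symm
        have hone : (QuotientGroup.mk' (etaTerm p G (i + (k + 1 + 1))) (x * y * x⁻¹ * y⁻¹)) ^ p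
            = 1 := by
          rw [← map_pow]
          exact (QuotientGroup.eq_one_iff _).2 hp
        have hconj : (QuotientGroup.mk' (etaTerm p G (i + (k + 1 + 1))) (x * y * x⁻¹)) ^ p =
            (QuotientGroup.mk' (etaTerm p G (i + (k + 1 + 1))) y) ^ p := by
          have h : x * y * x⁻¹ = (x * y * x⁻¹ * y⁻¹) * y := by group
          rw [h, map_mul, (hcen y).symm.mul_pow, hone, one_mul]
        rw [← map_pow, ← map_pow, conj_pow, map_mul, map_inv, mul_inv_eq_iff_eq_mul] at hconj
        rw [← map_mul]
        exact hconj

theorem eta_isFilter (p : ℕ) (G : Type*) [Group G] : IsFilter (etaTerm p G) where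
  zero := rfl
  commutator_le := fun s t => etaTerm_commutator_le p G t s
  le_inf := fun s t => le_inf (etaTerm_antitone p G (Nat.le_add_right s t))
    (etaTerm_antitone p G (Nat.le_add_left t s))

/-- The exponent-`p` central series `η` of `G`, as a filter on `ℕ`. -/
def eta (p : ℕ) (G : Type*) [Group G] : NatFilter G := ⟨etaTerm p G, eta_isFilter p G⟩

/-- For `s > 0` the component `η_s / η_{s+1}` is a vector space over `ℤ/pℤ`. -/
instance (p : ℕ) (G : Type*) [Group G] (s : ℕ) [NeZero s] :
    Module (ZMod p) ((eta p G).Layer s) :=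
  AddCommGroup.zmodModule <| by
    intro u
    obtain ⟨x, rfl⟩ := (eta p G).toLayer_surjective s u
    refine (((eta p G).toLayer_eq_iff s 1 (x ^ p)).2 ?_).symm
    have h : (x : G) ^ p ∈ eta p G (s + 1) := pow_mem_etaTerm p G (NeZero.ne s) x.2
    simpa using h

end AdjRefine

/-!
Write `b₁`, `b₂` for the coordinates of the bracket `L_s × L_s → L_{2s}` with respect to a basis of
`L_{2s}`. They are alternating forms on a space of odd dimension, so the radical of `b₁` is again of
odd dimension and `b₂` degenerates on it: there is `f ≠ 0` with `b₁(f, ·) = 0` and `b₂(f, k) = 0`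
for all `k` in the radical of `b₁`. The rank-one map `u ↦ b₂(u, f) f` (or `u ↦ ℓ[u, w] f` for a
functional `ℓ`, if `f` is in the radical of the bracket) then has an adjoint, and the pair generates
an ideal of square zero in `Adj`. Hence it lies in `J` and `L_s J ≠ 0`, while `L_s J ≠ L_s` by
Nakayama's lemma, and `L_s Jⁱ` reaches `0` because `J` is nilpotent.

The generated family is the least one that contains `π` and is closed under commutation with it.
As `φ_s = G`, the family `π` itself, extended by `φ` beyond the component `s`, is closed in this
sense, so `α` agrees with `π` up to the component `s`.
-/

namespace AdjRefine

section LinearAlgebra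

open Matrix Module

theorem det_sub_transpose_eq_zero {R n : Type*} [CommRing R] [Fintype n] [DecidableEq n]
    (hn : Odd (Fintype.card n)) (M : Matrix n n R) : (M - Mᵀ).det = 0 := by
  -- The determinant is its own negative, which settles the generic matrix over `ℤ`, where `2` is
  -- not a zero divisor; every other matrix is a specialization of that one.
  have generic : (mvPolynomialX n n ℤ - (mvPolynomialX n n ℤ)ᵀ).det = 0 := by
    rw [← self_eq_neg]
    conv_lhs => rw [← det_transpose, transpose_sub, transpose_transpose, ← neg_sub, det_neg,
      hn.neg_one_pow, neg_one_mul]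
  have special := congrArg
    (MvPolynomial.eval₂Hom (Int.castRingHom R) fun q : n × n => M q.1 q.2) generic
  rw [RingHom.map_det, map_zero] at special
  convert! special using 2
  ext i j
  simp [mvPolynomialX]

theorem det_eq_zero_of_transpose_eq_neg {R n : Type*} [CommRing R] [Fintype n] [LinearOrder n]
    (hn : Odd (Fintype.card n)) {A : Matrix n n R} (hA : Aᵀ = -A) (hdiag : ∀ i, A i i = 0) :
    A.det = 0 := by
  let U : Matrix n n R := of fun i j => if i < j then A i j else 0
  have hU : A = U - Uᵀ := by
    ext i j
    have hij : A j i = -A i j := congrFun₂ hA i j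
    rcases lt_trichotomy i j with h | rfl | h
    · simp [U, h, h.not_gt]
    · simp [U, hdiag]
    · simp [U, h, h.not_gt, hij]
  rw [hU, det_sub_transpose_eq_zero hn]

variable {K V : Type*} [Field K] [AddCommGroup V] [Module K V]

theorem not_separatingLeft_of_isAlt_of_odd_finrank {b : V →ₗ[K] V →ₗ[K] K} (hb : b.IsAlt)
    (hV : Odd (finrank K V)) : ¬ b.SeparatingLeft := by
  have : FiniteDimensional K V := Module.finite_of_finrank_pos hV.pos
  rw [LinearMap.separatingLeft_iff_det_ne_zero (finBasis K V), not_not]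
  refine det_eq_zero_of_transpose_eq_neg (by simpa using hV) ?_ fun i => ?_
  · ext i j
    simp [LinearMap.toMatrix₂_apply, hb.neg]
  · simp [LinearMap.toMatrix₂_apply, hb.self_eq_zero]

theorem separatingLeft_domRestrict₁₂_of_isCompl_ker {b : V →ₗ[K] V →ₗ[K] K} (hb : b.IsRefl)
    {C : Submodule K V} (hC : IsCompl (LinearMap.ker b) C) :
    (b.domRestrict₁₂ C C).SeparatingLeft := by
  intro v hv
  suffices hker : (v : V) ∈ LinearMap.ker b from
    Subtype.ext (Submodule.disjoint_def.1 hC.disjoint _ hker v.2)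
  refine LinearMap.mem_ker.2 (LinearMap.ext fun w => ?_)
  obtain ⟨k, hk, c, hc, rfl⟩ := Submodule.mem_sup.1 (hC.sup_eq_top ▸ Submodule.mem_top : w ∈ _)
  have hvk : b v k = 0 := hb.eq_zero (LinearMap.congr_fun hk v)
  have hvc : b v c = 0 := hv ⟨c, hc⟩
  rw [map_add, hvk, hvc, add_zero, LinearMap.zero_apply]

theorem odd_finrank_ker_of_isAlt {b : V →ₗ[K] V →ₗ[K] K} (hb : b.IsAlt)
    (hV : Odd (finrank K V)) : Odd (finrank K (LinearMap.ker b)) := by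
  have : FiniteDimensional K V := Module.finite_of_finrank_pos hV.pos
  obtain ⟨C, hC⟩ := Submodule.exists_isCompl (LinearMap.ker b)
  have hCeven : Even (finrank K C) := Nat.not_odd_iff_even.1 fun hodd =>
    not_separatingLeft_of_isAlt_of_odd_finrank (b := b.domRestrict₁₂ C C) (fun v => hb v) hodd
      (separatingLeft_domRestrict₁₂_of_isCompl_ker hb.isRefl hC)
  rw [← Submodule.finrank_add_eq_of_isCompl hC] at hV
  exact (Nat.odd_add.1 hV).2 hCeven

theorem exists_ne_zero_mem_ker_of_isAlt_of_isAlt {b₁ b₂ : V →ₗ[K] V →ₗ[K] K} (h₁ : b₁.IsAlt)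
    (h₂ : b₂.IsAlt) (hV : Odd (finrank K V)) :
    ∃ f ≠ 0, b₁ f = 0 ∧ ∀ k, b₁ k = 0 → b₂ f k = 0 := by
  have hdegenerate := not_separatingLeft_of_isAlt_of_odd_finrank
    (b := b₂.domRestrict₁₂ (LinearMap.ker b₁) (LinearMap.ker b₁)) (fun v => h₂ v)
    (odd_finrank_ker_of_isAlt h₁ hV)
  rw [LinearMap.SeparatingLeft] at hdegenerate
  push Not at hdegenerate
  obtain ⟨f, hf, hf0⟩ := hdegenerate
  exact ⟨f, by simpa using hf0, f.2, fun k hk => hf ⟨k, hk⟩⟩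

end LinearAlgebra

section AdjointPairs

variable {R V W : Type*} [CommRing R] [AddCommGroup V] [Module R V] [AddCommGroup W] [Module R W]

/-- `(X, Y)` is an adjoint pair of `b` that generates an ideal of square zero: `X A X = 0` and
`Y B Y = 0` for every adjoint pair `(A, B)`. As the ring of adjoints of a bracket consists of pairs
of additive maps, `A` and `B` are not required to be linear. -/
structure IsSquareZeroAdjointPair (b : V →ₗ[R] V →ₗ[R] W) (X Y : V →ₗ[R] V) : Prop where
  isAdjointPair : b.IsAdjointPair b X Y
  left_eq_zero : ∀ A B : V → V, b.IsAdjointPair b A B → ∀ u, X (A (X u)) = 0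
  right_eq_zero : ∀ A B : V → V, b.IsAdjointPair b A B → ∀ v, Y (B (Y v)) = 0

theorem isSquareZeroAdjointPair_of_apply_eq_zero {b : V →ₗ[R] V →ₗ[R] W} {f : V} (hf : b f = 0)
    (ℓ : W →ₗ[R] R) (w : V) :
    IsSquareZeroAdjointPair b (((b.compr₂ ℓ).flip w).smulRight f) 0 where
  isAdjointPair u v := by simp [hf]
  left_eq_zero A B hAB u := by simp [hAB _ w, hf]
  right_eq_zero _ _ _ _ := rfl

theorem isSquareZeroAdjointPair_smulRight {b : V →ₗ[R] V →ₗ[R] W} (hb : b.IsAlt)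
    {ℓ₁ ℓ₂ : W →ₗ[R] R} (hℓ : ∀ x y, ℓ₁ x = ℓ₁ y → ℓ₂ x = ℓ₂ y → x = y) {f : V}
    (hf₁ : b.compr₂ ℓ₁ f = 0) (hf₂ : ∀ k, b.compr₂ ℓ₁ k = 0 → b.compr₂ ℓ₂ f k = 0) :
    IsSquareZeroAdjointPair b (((b.compr₂ ℓ₂).flip f).smulRight f)
      ((b.compr₂ ℓ₂ f).smulRight f) := by
  have hleft (v : V) : ℓ₁ (b f v) = 0 := LinearMap.congr_fun hf₁ v
  have hright (u : V) : ℓ₁ (b u f) = 0 := by rw [← hb.neg, map_neg, hleft, neg_zero]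
  refine ⟨fun u v => hℓ _ _ ?_ ?_, fun A B hAB u => ?_, fun A B hAB v => ?_⟩
  · simp [hleft, hright]
  · simp [mul_comm]
  · have hA (a : R) : ℓ₂ (b (A (a • f)) f) = 0 := by
      rw [← hb.neg, map_neg, neg_eq_zero]
      refine hf₂ _ (LinearMap.ext fun v => ?_)
      simp [hAB _ v, hleft]
    simp [hA]
  · have hB (a : R) : ℓ₂ (b f (B (a • f))) = 0 := by
      refine hf₂ _ (LinearMap.ext fun v => ?_)
      simp [← hb.neg v, ← hAB v _, hright]
    simp [hB]

open Module in
theorem exists_ne_zero_isSquareZeroAdjointPair {K V W : Type*} [Field K] [AddCommGroup V]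
    [Module K V] [AddCommGroup W] [Module K W] {b : V →ₗ[K] V →ₗ[K] W} (hb : b.IsAlt)
    (hb0 : b ≠ 0) (hV : Odd (finrank K V)) (hW : finrank K W = 2) :
    ∃ X Y : V →ₗ[K] V, X ≠ 0 ∧ IsSquareZeroAdjointPair b X Y := by
  have : FiniteDimensional K W := Module.finite_of_finrank_pos (by omega)
  let e := finBasisOfFinrankEq K W hW
  have hcoord (x y : W) (h₀ : e.coord 0 x = e.coord 0 y) (h₁ : e.coord 1 x = e.coord 1 y) :
      x = y :=
    e.ext_elem (Fin.forall_fin_two.2 ⟨h₀, h₁⟩)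
  have halt (i : Fin 2) : (b.compr₂ (e.coord i)).IsAlt := fun v => by simp [hb.self_eq_zero]
  obtain ⟨f, hf0, hf₀, hf₁⟩ := exists_ne_zero_mem_ker_of_isAlt_of_isAlt (halt 0) (halt 1) hV
  by_cases hf : b f = 0
  · obtain ⟨u, w, huw⟩ : ∃ u w, b u w ≠ 0 := by
      by_contra! h
      exact hb0 (LinearMap.ext₂ h)
    obtain ⟨ℓ, hℓ⟩ := Projective.exists_dual_ne_zero K huw
    refine ⟨_, 0, fun hX => ?_, isSquareZeroAdjointPair_of_apply_eq_zero hf ℓ w⟩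
    simpa [hf0, hℓ] using LinearMap.congr_fun hX u
  · refine ⟨_, _, fun hX => hf (LinearMap.ext fun v => ?_),
      isSquareZeroAdjointPair_smulRight hb hcoord hf₀ hf₁⟩
    have hv₁ : e.coord 1 (b f v) = 0 := by
      simpa [hf0, ← hb.neg f] using LinearMap.congr_fun hX v
    exact hcoord _ _ (by simpa using LinearMap.congr_fun hf₀ v) (by simpa using hv₁)

end AdjointPairs

theorem mem_jacobson_of_forall_mul_mul_eq_zero {R : Type*} [Ring R] {x : R}
    (h : ∀ a, x * a * x = 0) : x ∈ Ring.jacobson R := by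
  rw [← Ideal.jacobson_bot, Ideal.mem_jacobson_iff]
  refine fun y => ⟨1 - y * x, Ideal.mem_bot.2 ?_⟩
  calc (1 - y * x) * y * x + (1 - y * x) - 1 = -(y * (x * y * x)) := by noncomm_ring
    _ = 0 := by rw [h, mul_zero, neg_zero]

section Generate

variable {G : Type*} [Group G]

theorem commutator_le_iff_le_comap_centralizer (A B N : Subgroup G) [N.Normal] :
    ⁅A, B⁆ ≤ N ↔ A ≤ (Subgroup.centralizer (B.map (QuotientGroup.mk' N))).comap
      (QuotientGroup.mk' N) := by
  rw [commutator_le_iff_map, Subgroup.commutator_eq_bot_iff_le_centralizer,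
    Subgroup.map_le_iff_le_comap]

theorem exists_forall_commutator_le_iff {ι : Type*} (A N : ι → Subgroup G)
    (hN : ∀ i, (N i).Normal) : ∃ C : Subgroup G, ∀ B, B ≤ C ↔ ∀ i, ⁅A i, B⁆ ≤ N i := by
  refine ⟨⨅ i, (Subgroup.centralizer ((A i).map (QuotientGroup.mk' (N i)))).comap
    (QuotientGroup.mk' (N i)), fun B => ?_⟩
  simp only [le_iInf_iff, ← commutator_le_iff_le_comap_centralizer, Subgroup.commutator_comm B]

theorem commutator_commutator_le_of_rotate {A B C N : Subgroup G} [N.Normal]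
    (h₁ : ⁅⁅A, B⁆, C⁆ ≤ N) (h₂ : ⁅⁅A, C⁆, B⁆ ≤ N) : ⁅A, ⁅B, C⁆⁆ ≤ N := by
  rw [Subgroup.commutator_comm A C] at h₂
  rw [Subgroup.commutator_comm]
  rw [commutator_le_iff_map, Subgroup.map_commutator] at *
  exact Subgroup.commutator_commutator_eq_bot_of_rotate h₂ h₁

theorem iterComm_append_singleton (A : Subgroup G) (l : List (Subgroup G)) (B : Subgroup G) :
    iterComm A (l ++ [B]) = ⁅iterComm A l, B⁆ := by
  rw [iterComm, List.foldl_append, List.foldl_cons, List.foldl_nil, iterComm]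

theorem iterComm_normal (A : Subgroup G) (l : List (Subgroup G)) (hA : A.Normal)
    (hl : ∀ B ∈ l, B.Normal) : (iterComm A l).Normal := by
  induction l using List.reverseRecOn with
  | nil => exact hA
  | append_singleton l B ih =>
    rw [iterComm_append_singleton]
    have := ih fun C hC => hl C (by simp [hC])
    have := hl B (by simp)
    infer_instance

variable {M : Type*} [AddCommMonoid M] {X : Set M} {π : M → Subgroup G}

theorem iterComm_le_generate {a : M} {l : List M} (h : ∀ b ∈ a :: l, b ∈ X) :
    iterComm (π a) (l.map π) ≤ generate X π (a :: l).sum :=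
  le_iSup_of_le a <| le_iSup_of_le l <| le_iSup_of_le ⟨h, rfl⟩ le_rfl

theorem le_generate {a : M} (h : a ∈ X) : π a ≤ generate X π a := by
  simpa [iterComm] using iterComm_le_generate (π := π) (a := a) (l := []) (by simpa using h)

theorem generate_normal (hπ : ∀ a, (π a).Normal) (s : M) : (generate X π s).Normal := by
  have (a : M) (l : List M) : (iterComm (π a) (l.map π)).Normal :=
    iterComm_normal _ _ (hπ a) (by simpa using fun b _ => hπ b)
  unfold generate
  infer_instance

theorem commutator_generate_le_generate_add (hπ : ∀ a, (π a).Normal) (s : M) {c : M}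
    (hc : c ∈ X) : ⁅generate X π s, π c⁆ ≤ generate X π (s + c) := by
  have := generate_normal (X := X) hπ (s + c)
  rw [commutator_le_iff_le_comap_centralizer]
  refine iSup_le fun a => iSup_le fun l => iSup_le ?_
  rintro ⟨hl, rfl⟩
  have hlc : ∀ b ∈ a :: (l ++ [c]), b ∈ X := by
    rw [← List.cons_append, List.forall_mem_append]
    exact ⟨hl, by simpa using hc⟩
  rw [← commutator_le_iff_le_comap_centralizer, ← iterComm_append_singleton, ← List.map_singleton,
    ← List.map_append]
  simpa [add_assoc] using iterComm_le_generate (π := π) hlc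

theorem generate_le_of_commutator_le {Γ : M → Subgroup G} (hπ : ∀ a ∈ X, π a ≤ Γ a)
    (hΓ : ∀ s, ∀ c ∈ X, ⁅Γ s, π c⁆ ≤ Γ (s + c)) (s : M) : generate X π s ≤ Γ s := by
  refine iSup_le fun a => iSup_le fun l => iSup_le ?_
  rintro ⟨hl, rfl⟩
  induction l using List.reverseRecOn with
  | nil => simpa [iterComm] using hπ a (hl a (by simp))
  | append_singleton l c ih =>
    rw [← List.cons_append, List.forall_mem_append] at hl
    rw [List.map_append, List.map_singleton, iterComm_append_singleton, ← List.cons_append,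
      List.sum_append, List.sum_singleton]
    exact (Subgroup.commutator_mono (ih hl.1) le_rfl).trans (hΓ _ c (hl.2 c (by simp)))

theorem commutator_generate_generate_le (hπ : ∀ a, (π a).Normal) (s t : M) :
    ⁅generate X π s, generate X π t⁆ ≤ generate X π (s + t) := by
  choose Γ hΓ using fun t => exists_forall_commutator_le_iff (generate X π)
    (fun s => generate X π (s + t)) fun s => generate_normal hπ (s + t)
  refine (hΓ t _).1 (generate_le_of_commutator_le (fun a ha => ?_) (fun t c hc => ?_) t) s
  · exact (hΓ a _).2 fun s => commutator_generate_le_generate_add hπ s ha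
  · have hΓt (s : M) : ⁅generate X π s, Γ t⁆ ≤ generate X π (s + t) := (hΓ t _).1 le_rfl s
    refine (hΓ (t + c) _).2 fun s => ?_
    have := generate_normal (X := X) hπ (s + (t + c))
    refine commutator_commutator_le_of_rotate ?_ ?_
    · rw [← add_assoc]
      exact (Subgroup.commutator_mono (hΓt s) le_rfl).trans
        (commutator_generate_le_generate_add hπ _ hc)
    · rw [add_comm t, ← add_assoc]
      exact (Subgroup.commutator_mono (commutator_generate_le_generate_add hπ s hc) le_rfl).trans
        (hΓt (s + c))

theorem generate_antitone [Preorder M] (hX : IsLowerSet X) (hπ : ∀ a, (π a).Normal)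
    (hanti : AntitoneOn π X)
    (hM : ∀ x z c : M, x ≤ z + c → ∃ z' ≤ z, ∃ c' ≤ c, z' + c' = x) :
    Antitone (generate X π) := by
  intro x y hxy
  suffices h : generate X π y ≤ ⨅ w ≤ y, generate X π w from h.trans (iInf₂_le x hxy)
  refine generate_le_of_commutator_le (Γ := fun y => ⨅ w ≤ y, generate X π w)
    (fun a ha => le_iInf₂ fun w hwa => ?_) (fun z c hc => le_iInf₂ fun w hw => ?_) y
  · exact (hanti (hX hwa ha) ha hwa).trans (le_generate (hX hwa ha))
  · obtain ⟨z', hz', c', hc', rfl⟩ := hM w z c hw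
    exact (Subgroup.commutator_mono (iInf₂_le z' hz') (hanti (hX hc' hc) hc hc')).trans
      (commutator_generate_le_generate_add hπ z' (hX hc' hc))

theorem isFilter_generate [Preorder M] (hπ : ∀ a, (π a).Normal) (h0 : 0 ∈ X) (hπ0 : π 0 = ⊤)
    (hanti : Antitone (generate X π)) (hM : ∀ s t : M, s ≤ s + t) : IsFilter (generate X π) where
  zero := top_le_iff.1 (hπ0.ge.trans (le_generate h0))
  commutator_le := commutator_generate_generate_le hπ
  le_inf s t := le_inf (hanti (hM s t)) (hanti (add_comm t s ▸ hM t s))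

end Generate

section Lex

theorem lt_toLex_succ_zero_iff {s : ℕ} {x : ℕ ×ₗ ℕ} : x < toLex (s + 1, 0) ↔ (ofLex x).1 ≤ s := by
  simp [Prod.Lex.lt_iff]

theorem lex_le_add (x y : ℕ ×ₗ ℕ) : x ≤ x + y := by
  simp only [Prod.Lex.le_iff, ofLex_add, Prod.fst_add, Prod.snd_add]
  omega

theorem lex_exists_add_eq_of_le_add (x z c : ℕ ×ₗ ℕ) (h : x ≤ z + c) :
    ∃ z' ≤ z, ∃ c' ≤ c, z' + c' = x := by
  obtain ⟨⟨u, i⟩, rfl⟩ := toLex.surjective x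
  obtain ⟨⟨w, k⟩, rfl⟩ := toLex.surjective z
  obtain ⟨⟨v, j⟩, rfl⟩ := toLex.surjective c
  suffices hcoord : ∃ a b d e : ℕ, toLex (a, b) ≤ toLex (w, k) ∧ toLex (d, e) ≤ toLex (v, j) ∧
      a + d = u ∧ b + e = i by
    obtain ⟨a, b, d, e, hz, hc, rfl, rfl⟩ := hcoord
    exact ⟨_, hz, _, hc, rfl⟩
  rw [← toLex_add] at h
  simp only [Prod.Lex.toLex_le_toLex, Prod.fst_add, Prod.snd_add] at h ⊢
  by_cases hxz : u < w ∨ u = w ∧ i ≤ k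
  · exact ⟨u, i, 0, 0, by omega⟩
  rcases eq_or_ne u (w + v) with huv | huv
  · exact ⟨w, min i k, v, i - min i k, by omega⟩
  rcases Nat.eq_zero_or_pos w with hw | hw
  · exact ⟨0, 0, u, i, by omega⟩
  · exact ⟨w - 1, i, u - w + 1, 0, by omega⟩

end Lex

namespace NatFilter

variable {G : Type*} [Group G] (φ : NatFilter G)

section Adjoints

variable (s t : ℕ) [NeZero s] [NeZero t]

instance : Module (φ.AdjRing s t) (φ.Layer s) := Module.compHom _ (φ.actLeft s t)

instance [Finite (φ.Layer s)] [Finite (φ.Layer t)] : Finite (φ.AdjRing s t) := by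
  have : Finite (AddMonoid.End (φ.Layer s)) := DFunLike.finite _
  have : Finite (AddMonoid.End (φ.Layer t)) := DFunLike.finite _
  have : Finite (AddMonoid.End (φ.Layer t))ᵐᵒᵖ := Finite.of_equiv _ MulOpposite.opEquiv
  exact Finite.of_injective _ (Subtype.val_injective (p := (· ∈ φ.Adj s t)))

/-- The graded product `[,] : L_s × L_t → L_{s+t}` as a bilinear map over `ℤ/n`, available when `n`
annihilates the three components involved. -/
def zmodBracket (n : ℕ) [Module (ZMod n) (φ.Layer s)] [Module (ZMod n) (φ.Layer t)]
    [Module (ZMod n) (φ.Layer (s + t))] :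
    φ.Layer s →ₗ[ZMod n] φ.Layer t →ₗ[ZMod n] φ.Layer (s + t) :=
  AddMonoidHom.toZModLinearMap n
    { toFun := fun u => AddMonoidHom.toZModLinearMap n (φ.bracket s t u)
      map_zero' := by
        rw [map_zero]
        rfl
      map_add' := fun u v => by
        rw [map_add]
        rfl }

variable {s t}

theorem exists_mem_jacobson_of_isSquareZeroAdjointPair {n : ℕ} [Module (ZMod n) (φ.Layer s)]
    [Module (ZMod n) (φ.Layer (s + s))] {X Y : φ.Layer s →ₗ[ZMod n] φ.Layer s}
    (h : IsSquareZeroAdjointPair (φ.zmodBracket s s n) X Y) :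
    ∃ A ∈ Ring.jacobson (φ.AdjRing s s), ∀ u : φ.Layer s, A • u = X u := by
  let A : φ.AdjRing s s :=
    ⟨(X.toAddMonoidHom, MulOpposite.op Y.toAddMonoidHom), h.isAdjointPair⟩
  refine ⟨A, mem_jacobson_of_forall_mul_mul_eq_zero fun B => ?_, fun u => rfl⟩
  have hB : (φ.zmodBracket s s n).IsAdjointPair (φ.zmodBracket s s n) B.1.1 B.1.2.unop := B.2
  exact Subtype.ext <| Prod.ext (AddMonoidHom.ext (h.left_eq_zero _ _ hB))
    (MulOpposite.unop_injective (AddMonoidHom.ext (h.right_eq_zero _ _ hB)))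

end Adjoints

section Layers

theorem toLayer_eq_zero_iff (s : ℕ) (x : φ s) : φ.toLayer s x = 0 ↔ (x : G) ∈ φ (s + 1) := by
  refine eq_comm.trans ((φ.toLayer_eq_iff s 1 x).trans ?_)
  rw [OneMemClass.coe_one, inv_one, one_mul]

variable {s t : ℕ} [NeZero s] [NeZero t]

theorem bracket_self (u : φ.Layer s) : φ.bracket s s u u = 0 := by
  obtain ⟨x, rfl⟩ := φ.toLayer_surjective s u
  rw [bracket_toLayer, toLayer_eq_zero_iff]
  simp [mul_assoc]

theorem commutator_le_of_bracket_eq_zero (h : φ.bracket s t = 0) :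
    ⁅φ s, φ t⁆ ≤ φ (s + t + 1) := by
  refine Subgroup.commutator_le.2 fun x hx y hy => ?_
  have hxy : φ.bracket s t (φ.toLayer s ⟨x, hx⟩⁻¹) (φ.toLayer t ⟨y, hy⟩⁻¹) = 0 := by
    rw [h, AddMonoidHom.zero_apply, AddMonoidHom.zero_apply]
  rw [bracket_toLayer, toLayer_eq_zero_iff] at hxy
  simpa [commutatorElement_def] using hxy

end Layers

section Radical

variable (s : ℕ) [NeZero s]

theorem radLayer_eq_smul_top (i : ℕ) : φ.radLayer s i =
    (Ring.jacobson (φ.AdjRing s s) ^ i • (⊤ : Submodule (φ.AdjRing s s) (φ.Layer s))).toAddSubgroup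
    := by
  refine le_antisymm ((AddSubgroup.closure_le _).2 ?_) fun w hw => ?_
  · rintro _ ⟨A, hA, u, rfl⟩
    exact Submodule.smul_mem_smul hA Submodule.mem_top
  · exact Submodule.smul_induction_on hw
      (fun A hA u _ => AddSubgroup.subset_closure ⟨A, hA, u, rfl⟩) fun _ _ => add_mem

theorem H_le (i : ℕ) : φ.H s i ≤ φ s := fun g hg => ((φ.mem_H s i g).1 hg).1

theorem le_H (i : ℕ) : φ (s + 1) ≤ φ.H s i := by
  intro g hg
  have hgs : g ∈ φ s := φ.antitone (Nat.le_succ s) hg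
  refine (φ.mem_H s i g).2 ⟨hgs, ?_⟩
  rw [(φ.toLayer_eq_zero_iff s ⟨g, hgs⟩).2 hg]
  exact zero_mem _

theorem H_antitone : Antitone (φ.H s) := fun i j hij => by
  refine Subgroup.map_mono (Subgroup.comap_mono (?_ : φ.radLayer s j ≤ φ.radLayer s i))
  rw [radLayer_eq_smul_top, radLayer_eq_smul_top]
  exact Submodule.smul_mono_left (Ideal.pow_le_pow_right hij)

theorem H_eq_iff_radLayer_eq_top {i : ℕ} : φ.H s i = φ s ↔ φ.radLayer s i = ⊤ := by
  refine ⟨fun h => eq_top_iff.2 fun w _ => ?_, fun h => le_antisymm (φ.H_le s i) fun g hg => ?_⟩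
  · obtain ⟨x, rfl⟩ := φ.toLayer_surjective s w
    exact ((φ.mem_H s i x).1 (h.ge x.2)).2
  · exact (φ.mem_H s i g).2 ⟨hg, h ▸ AddSubgroup.mem_top _⟩

theorem H_eq_iff_radLayer_eq_bot {i : ℕ} : φ.H s i = φ (s + 1) ↔ φ.radLayer s i = ⊥ := by
  refine ⟨fun h => eq_bot_iff.2 fun w hw => ?_, fun h => le_antisymm (fun g hg => ?_) (φ.le_H s i)⟩
  · obtain ⟨x, rfl⟩ := φ.toLayer_surjective s w
    exact (φ.toLayer_eq_zero_iff s x).2 (h.le ((φ.mem_H s i x).2 ⟨x.2, hw⟩))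
  · obtain ⟨hgs, hgJ⟩ := (φ.mem_H s i g).1 hg
    exact (φ.toLayer_eq_zero_iff s ⟨g, hgs⟩).1 (by rwa [h] at hgJ)

theorem H_zero : φ.H s 0 = φ s := by
  rw [H_eq_iff_radLayer_eq_top, radLayer_eq_smul_top, Submodule.pow_zero, Ideal.one_eq_top,
    Submodule.top_smul, Submodule.top_toAddSubgroup]

theorem H_eq_of_pow_eq_bot {i : ℕ} (h : Ring.jacobson (φ.AdjRing s s) ^ i = ⊥) :
    φ.H s i = φ (s + 1) := by
  rw [H_eq_iff_radLayer_eq_bot, radLayer_eq_smul_top, h, Submodule.bot_smul,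
    Submodule.bot_toAddSubgroup]

theorem lt_H_one {A : φ.AdjRing s s} (hA : A ∈ Ring.jacobson (φ.AdjRing s s)) {u : φ.Layer s}
    (hu : A • u ≠ 0) : φ (s + 1) < φ.H s 1 := by
  refine (φ.le_H s 1).lt_of_ne fun h => hu ?_
  have hmem : A • u ∈ φ.radLayer s 1 :=
    AddSubgroup.subset_closure ⟨A, by rwa [Submodule.pow_one], u, rfl⟩
  rwa [(φ.H_eq_iff_radLayer_eq_bot s).1 h.symm] at hmem

theorem H_one_lt [Nontrivial (φ.Layer s)] [Module.Finite (φ.AdjRing s s) (φ.Layer s)] :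
    φ.H s 1 < φ s := by
  refine (φ.H_le s 1).lt_of_ne fun h => ?_
  rw [H_eq_iff_radLayer_eq_top, radLayer_eq_smul_top, Submodule.pow_one,
    ← Submodule.top_toAddSubgroup (R := φ.AdjRing s s)] at h
  exact (Submodule.jacobson_smul_lt_top ⊤).ne (Submodule.toAddSubgroup_injective h)

variable {s}

theorem H_normal (hs : φ s = ⊤) (i : ℕ) : (φ.H s i).Normal := by
  rw [← Subgroup.commutator_top_left_le_iff, ← hs]
  calc ⁅φ s, φ.H s i⁆ ≤ ⁅φ s, φ s⁆ := Subgroup.commutator_mono le_rfl (φ.H_le s i)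
    _ ≤ φ (s + s) := φ.isFilter.commutator_le s s
    _ ≤ φ (s + 1) := φ.antitone (Nat.add_le_add_left NeZero.one_le s)
    _ ≤ φ.H s i := φ.le_H s i

end Radical

section Refinement

variable (s : ℕ) [NeZero s]

theorem preAdjoint_of_ne {x : ℕ ×ₗ ℕ} (h : (ofLex x).1 ≠ s) :
    φ.preAdjoint s x = φ (ofLex x).1 := if_pos (Or.inr h)

theorem preAdjoint_toLex_zero (u : ℕ) : φ.preAdjoint s (toLex (u, 0)) = φ u := if_pos (Or.inl rfl)

theorem preAdjoint_of_eq {x : ℕ ×ₗ ℕ} (h : (ofLex x).1 = s) :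
    φ.preAdjoint s x = φ.H s (ofLex x).2 := by
  rcases eq_or_ne (ofLex x).2 0 with h0 | h0
  · rw [preAdjoint, if_pos (Or.inl h0), h0, H_zero, h]
  · exact if_neg (by simp [h, h0])

theorem preAdjoint_le (x : ℕ ×ₗ ℕ) : φ.preAdjoint s x ≤ φ (ofLex x).1 := by
  rcases eq_or_ne (ofLex x).1 s with h | h
  · rw [φ.preAdjoint_of_eq s h, h]
    exact φ.H_le s _
  · rw [φ.preAdjoint_of_ne s h]

theorem le_preAdjoint {x : ℕ ×ₗ ℕ} (hx : (ofLex x).1 ≤ s) : φ (s + 1) ≤ φ.preAdjoint s x := by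
  rcases eq_or_ne (ofLex x).1 s with h | h
  · rw [φ.preAdjoint_of_eq s h]
    exact φ.le_H s _
  · rw [φ.preAdjoint_of_ne s h]
    exact φ.antitone (by omega)

theorem preAdjoint_antitone : Antitone (φ.preAdjoint s) := by
  intro x y hxy
  rcases Prod.Lex.le_iff.1 hxy with hlt | ⟨heq, hle⟩
  · have hy : φ.preAdjoint s y ≤ φ (ofLex y).1 := φ.preAdjoint_le s y
    rcases eq_or_ne (ofLex x).1 s with hx | hx
    · exact hy.trans ((φ.antitone (hx ▸ hlt)).trans (φ.le_preAdjoint s hx.le))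
    · rw [φ.preAdjoint_of_ne s hx]
      exact hy.trans (φ.antitone hlt.le)
  · rcases eq_or_ne (ofLex x).1 s with hx | hx
    · rw [φ.preAdjoint_of_eq s hx, φ.preAdjoint_of_eq s (heq.symm.trans hx)]
      exact φ.H_antitone s hle
    · rw [φ.preAdjoint_of_ne s hx, φ.preAdjoint_of_ne s (heq ▸ hx), heq]

variable {s}

theorem preAdjoint_normal (hs : φ s = ⊤) (x : ℕ ×ₗ ℕ) : (φ.preAdjoint s x).Normal := by
  rcases eq_or_ne (ofLex x).1 s with h | h
  · rw [φ.preAdjoint_of_eq s h]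
    exact φ.H_normal hs _
  · rw [φ.preAdjoint_of_ne s h]
    exact φ.normal _

theorem commutator_preAdjoint_le (hs : φ s = ⊤) (x y : ℕ ×ₗ ℕ) :
    ⁅φ.preAdjoint s x, φ.preAdjoint s y⁆ ≤ φ.preAdjoint s (x + y) := by
  rcases le_or_gt (ofLex (x + y)).1 s with h | h
  · calc ⁅φ.preAdjoint s x, φ.preAdjoint s y⁆ ≤ ⁅φ s, φ s⁆ :=
          Subgroup.commutator_mono (le_top.trans hs.ge) (le_top.trans hs.ge)
      _ ≤ φ (s + s) := φ.isFilter.commutator_le s s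
      _ ≤ φ (s + 1) := φ.antitone (Nat.add_le_add_left NeZero.one_le s)
      _ ≤ φ.preAdjoint s (x + y) := φ.le_preAdjoint s h
  · rw [φ.preAdjoint_of_ne s h.ne']
    exact (Subgroup.commutator_mono (φ.preAdjoint_le s x) (φ.preAdjoint_le s y)).trans
      (φ.isFilter.commutator_le _ _)

theorem adjointFilter_le_preAdjoint (hs : φ s = ⊤) (x : ℕ ×ₗ ℕ) :
    adjointFilter φ s x ≤ φ.preAdjoint s x :=
  generate_le_of_commutator_le (fun _ _ => le_rfl)
    (fun x c _ => φ.commutator_preAdjoint_le hs x c) x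

theorem adjointFilter_eq_preAdjoint (hs : φ s = ⊤) {x : ℕ ×ₗ ℕ} (hx : (ofLex x).1 ≤ s) :
    adjointFilter φ s x = φ.preAdjoint s x :=
  (φ.adjointFilter_le_preAdjoint hs x).antisymm (le_generate (lt_toLex_succ_zero_iff.2 hx))

theorem adjointFilter_toLex_self (hs : φ s = ⊤) (i : ℕ) :
    adjointFilter φ s (toLex (s, i)) = φ.H s i :=
  (φ.adjointFilter_eq_preAdjoint hs le_rfl).trans (φ.preAdjoint_of_eq s rfl)

theorem adjointFilter_antitone (hs : φ s = ⊤) : Antitone (adjointFilter φ s) :=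
  generate_antitone (isLowerSet_Iio _) (φ.preAdjoint_normal hs)
    ((φ.preAdjoint_antitone s).antitoneOn _) lex_exists_add_eq_of_le_add

theorem adjointFilter_isFilter (hs : φ s = ⊤) : IsFilter (adjointFilter φ s) :=
  isFilter_generate (φ.preAdjoint_normal hs) (lt_toLex_succ_zero_iff.2 (Nat.zero_le s))
    ((φ.preAdjoint_toLex_zero s 0).trans φ.isFilter.zero) (φ.adjointFilter_antitone hs) lex_le_add

theorem isProperRefinement_adjointFilter (hs : φ s = ⊤)
    [Module.Finite (φ.AdjRing s s) (φ.Layer s)] (hJ : IsNilpotent (Ring.jacobson (φ.AdjRing s s)))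
    {A : φ.AdjRing s s} (hA : A ∈ Ring.jacobson (φ.AdjRing s s)) {u : φ.Layer s}
    (hu : A • u ≠ 0) : IsProperRefinement φ s (adjointFilter φ s) where
  isFilter := φ.adjointFilter_isFilter hs
  antitone := φ.adjointFilter_antitone hs
  le u i := (φ.adjointFilter_le_preAdjoint hs _).trans (φ.preAdjoint_le s _)
  eq u hu := (φ.adjointFilter_eq_preAdjoint hs (x := toLex (u, 0)) hu).trans
    (φ.preAdjoint_toLex_zero s u)
  eventually_eq := by
    obtain ⟨c, hc⟩ := hJ
    exact ⟨c, (φ.adjointFilter_toLex_self hs c).trans (φ.H_eq_of_pow_eq_bot s hc)⟩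
  proper := by
    have : Nontrivial (φ.Layer s) := ⟨_, _, hu⟩
    refine ⟨1, ?_⟩
    rw [φ.adjointFilter_toLex_self hs]
    exact ⟨φ.lt_H_one s hA hu, φ.H_one_lt s⟩

theorem isFirstLayer (hs : φ s = ⊤) (hlt : φ (s + 1) < φ s) : IsFirstLayer φ s := by
  refine ⟨⟨NeZero.ne s, hlt.ne'⟩, fun t ht => ?_⟩
  by_contra! hts
  have htop (r : ℕ) (hr : r ≤ s) : φ r = ⊤ := top_le_iff.1 (hs.ge.trans (φ.antitone hr))
  exact ht.2 ((htop t hts.le).trans (htop (t + 1) hts).symm)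

end Refinement

end NatFilter

end AdjRefine

theorem mainTheorem6_general (p : ℕ) [Fact p.Prime] {G : Type*} [Group G]
    (φ : AdjRefine.NatFilter G) (s : ℕ) [NeZero s] [Module (ZMod p) (φ.Layer s)]
    [Module (ZMod p) (φ.Layer (s + s))] (hs : φ s = ⊤)
    (hodd : Odd (Module.finrank (ZMod p) (φ.Layer s)))
    (htwo : Module.finrank (ZMod p) (φ.Layer (s + s)) = 2)
    (hcomm : ¬ ⁅φ s, φ s⁆ ≤ φ (s + s + 1)) :
    AdjRefine.HasProperLexLeastAdjointRefinement φ := by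
  open AdjRefine in
  have : Module.Finite (ZMod p) (φ.Layer s) := Module.finite_of_finrank_pos hodd.pos
  have : Finite (φ.Layer s) := Module.finite_of_finite (ZMod p)
  have hbracket : φ.zmodBracket s s p ≠ 0 := fun h => hcomm <|
    φ.commutator_le_of_bracket_eq_zero
      (AddMonoidHom.ext fun u => AddMonoidHom.ext (LinearMap.congr_fun₂ h u))
  obtain ⟨X, Y, hX, hXY⟩ :=
    exists_ne_zero_isSquareZeroAdjointPair (fun u => φ.bracket_self u) hbracket hodd htwo
  obtain ⟨A, hA, hAX⟩ := φ.exists_mem_jacobson_of_isSquareZeroAdjointPair hXY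
  obtain ⟨u, hu⟩ := DFunLike.ne_iff.1 hX
  have hproper := φ.isProperRefinement_adjointFilter hs IsSemiprimaryRing.isNilpotent hA
    (u := u) (by rwa [hAX])
  obtain ⟨i, hlt₁, hlt₂⟩ := hproper.proper
  exact ⟨s, inferInstance, φ.isFirstLayer hs (hlt₁.trans hlt₂), hproper⟩

theorem mainTheorem6 (p : ℕ) [Fact p.Prime] (G : Type*) [Group G] [Finite G] (hG : IsPGroup p G)
    (hodd : Odd (Module.finrank (ZMod p) ((AdjRefine.eta p G).Layer 1)))
    (htwo : Module.finrank (ZMod p) ((AdjRefine.eta p G).Layer 2) = 2)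
    (hcomm : ¬ ⁅AdjRefine.eta p G 1, AdjRefine.eta p G 1⁆ ≤ AdjRefine.eta p G 3) :
    AdjRefine.HasProperLexLeastAdjointRefinement (AdjRefine.eta p G) :=
  mainTheorem6_general p (AdjRefine.eta p G) 1 rfl hodd htwo hcomm
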